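/- Let $(\Omega,\mathcal A,\mathbb P)$ be a standard Borel probability space, $\mathcal B\subset\mathcal A$ a sub-$\sigma$-algebra, and $(M,d)$ a (non-empty) global NPC space, i.e. a complete metric space such that for all $x_0,x_1\in M$ there is $y\in M$ with $d^2(z,y)\le\frac12d^2(z,x_0)+\frac12d^2(z,x_1)-\frac14d^2(x_0,x_1)$ for all $z\in M$. For $1\le p\le\infty$ let $L^p(\Omega;M)=L^p(\Omega,\mathcal A,\mathbb P;M)$ be the set of strongly measurable $\varphi:\Omega\to M$ (modulo a.e. equality) such that $\omega\mapsto d(x,\varphi(\omega))$ lies in $L^p(\mathbb P)$ for some $x\in M$, with the metric $\mathbf d_p(\varphi,\psi)=\|d(\varphi(\cdot),\psi(\cdot))\|_{L^p(\mathbb P)}$; let $L^p(\Omega,\mathcal B,\mathbb P;M)$ be its subset of classes of $\mathcal B$-strongly measurable maps. Let $\mathcal P^1(M)$ be the set of Borel probability measures $\mu$ on $M$ that are concentrated on their support and satisfy $\int_M d(x,y)\,d\mu(y)<\infty$ for some $x\in M$. The canonical barycentric map $\lambda:\mathcal P^1(M)\to M$ is $$\lambda(\mu)=\operatorname*{arg\,min}_{z\in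 M}\int_M\bigl[d^2(z,x)-d^2(y,x)\bigr]\,d\mu(x),$$ independently of $y\in M$. Let $(\mathbb P_\omega)_{\omega\in\Omega}$ be the disintegration (regular conditional probability) of $\mathbb P$ with respect to $\mathcal B$, and for $\varphi\in L^1(\Omega;M)$ put $E^\lambda_{\mathcal B}(\varphi)(\omega)=\lambda(\varphi_*\mathbb P_\omega)$. Sturm's conditional expectation $\mathbb E_{\mathcal B}:L^1(\Omega;M)\to L^1(\Omega,\mathcal B,\mathbb P;M)$ is the $\mathbf d_1$-continuous extension to $L^1(\Omega;M)$ of the map $$\mathbb E_{\mathcal B}(\varphi)=\operatorname*{arg\,min}_{\psi\in L^2(\Omega,\mathcal B,\mathbb P;M)}\mathbf d_2(\varphi,\psi),\qquad\varphi\in L^2(\Omega;M).$$ Then $\lambda$ is well defined on $\mathcal P^1(M)$ (the minimizer exists and is unique), and $\mathbb E_{\mathcal B}$ is well defined on $L^1(\Omega;M)$ (it exists and is unique up to a.e. equality). Moreover, for every $p\in[1,\infty]$ and every $\varphi\in L^p(\Omega;M)$, one has $\varphi_*\mathbb P_\omega\in\mathcal P^1(M)$ for $\mathbb P$-a.e.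 $\omega$, $E^\lambda_{\mathcal B}(\varphi)\in L^p(\Omega,\mathcal B,\mathbb P;M)$, and $$\mathbb E_{\mathcal B}(\varphi)=E^\lambda_{\mathcal B}(\varphi)\quad\mathbb P\text{-a.e.}$$ -/

import Mathlib

open MeasureTheory ProbabilityTheory Filter Topology
open scoped ENNReal

/-- A global NPC space (CAT(0) or Hadamard space): a complete metric space in which any two points
`x₀, x₁` have a point `y` with
`d²(z, y) ≤ ½ d²(z, x₀) + ½ d²(z, x₁) - ¼ d²(x₀, x₁)` for all `z`. -/
structure IsGlobalNPC (M : Type*) [MetricSpace M] : Prop where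
  complete : CompleteSpace M
  exists_midpoint : ∀ x₀ x₁ : M, ∃ y : M, ∀ z : M,
    dist z y ^ 2 ≤ (1 / 2) * dist z x₀ ^ 2 + (1 / 2) * dist z x₁ ^ 2 - (1 / 4) * dist x₀ x₁ ^ 2

/-- `𝒫¹(M)`: Borel probability measures, concentrated on their support, with finite first
moment. -/
structure MemP1 {M : Type*} [MetricSpace M] [MeasurableSpace M] (μ : Measure M) : Prop where
  prob : IsProbabilityMeasure μ
  full_support : μ μ.supportᶜ = 0
  integrable_dist : ∃ x : M, Integrable (fun y => dist x y) μ

/-- `z` minimizes `z ↦ ∫ [d²(z, x) - d²(y, x)] dμ(x)`, for every base point `y`. -/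
def IsCanonicalBarycenter {M : Type*} [MetricSpace M] [MeasurableSpace M]
    (μ : Measure M) (z : M) : Prop :=
  ∀ y z' : M, ∫ x, (dist z x ^ 2 - dist y x ^ 2) ∂μ ≤ ∫ x, (dist z' x ^ 2 - dist y x ^ 2) ∂μ

/-- The canonical barycentric map `λ`: the minimizer above (arbitrary where there is none). -/
noncomputable def canonicalBarycenter {M : Type*} [MetricSpace M] [MeasurableSpace M] [Nonempty M]
    (μ : Measure M) : M :=
  Classical.epsilon (IsCanonicalBarycenter μ)

/-- The distance `𝐝_p(φ, ψ)`: the `L^p`-norm of `ω ↦ d(φ ω, ψ ω)`, with values in `[0, ∞]`. -/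
noncomputable def distLp {Ω M : Type*} [MeasurableSpace Ω] [MetricSpace M]
    (p : ℝ≥0∞) (P : Measure Ω) (φ ψ : Ω → M) : ℝ≥0∞ :=
  eLpNorm (fun ω => dist (φ ω) (ψ ω)) p P

/-- `φ ∈ L^p(Ω, 𝓑, P; M)`: up to a `P`-null set, `φ` is `𝓑`-strongly measurable, and
`ω ↦ d(x, φ ω)` has finite `L^p`-norm for some `x`. Functions are not yet identified when they
agree almost everywhere. -/
def MemLpMetric {Ω M : Type*} (𝓑 : MeasurableSpace Ω) [mΩ : MeasurableSpace Ω] [MetricSpace M]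
    (p : ℝ≥0∞) (P : Measure[mΩ] Ω) (φ : Ω → M) : Prop :=
  AEStronglyMeasurable[𝓑] φ P ∧ ∃ x : M, distLp p P (fun _ => x) φ < ∞

/-- `E` is Sturm's conditional expectation given `𝓑`: it maps `L¹(Ω, P; M)` to `L¹(Ω, 𝓑, P; M)`,
is `𝐝₁`-continuous there, and maps each `φ ∈ L²(Ω, P; M)` to a point of `L²(Ω, 𝓑, P; M)` at minimal
`𝐝₂`-distance from `φ`. -/
structure IsSturmCondExp {Ω M : Type*} (𝓑 : MeasurableSpace Ω) [mΩ : MeasurableSpace Ω]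
    [MetricSpace M] (P : Measure[mΩ] Ω) (E : (Ω → M) → (Ω → M)) : Prop where
  mapsTo : ∀ φ : Ω → M, MemLpMetric mΩ 1 P φ → MemLpMetric 𝓑 1 P (E φ)
  continuous : ∀ (φ : Ω → M) (φs : ℕ → Ω → M), MemLpMetric mΩ 1 P φ →
    (∀ k, MemLpMetric mΩ 1 P (φs k)) →
    Tendsto (fun k => distLp 1 P (φs k) φ) atTop (𝓝 0) →
    Tendsto (fun k => distLp 1 P (E (φs k)) (E φ)) atTop (𝓝 0)
  argmin : ∀ φ : Ω → M, MemLpMetric mΩ 2 P φ → MemLpMetric 𝓑 2 P (E φ) ∧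
    ∀ ψ : Ω → M, MemLpMetric 𝓑 2 P ψ → distLp 2 P φ (E φ) ≤ distLp 2 P φ ψ

/-- Sturm's conditional expectation `𝔼_𝓑` (arbitrary where there is none). -/
noncomputable def sturmCondExp {Ω M : Type*} (𝓑 : MeasurableSpace Ω) [mΩ : MeasurableSpace Ω]
    [MetricSpace M] (P : Measure[mΩ] Ω) : (Ω → M) → (Ω → M) :=
  @Classical.epsilon ((Ω → M) → (Ω → M)) ⟨id⟩ (IsSturmCondExp 𝓑 P)

/-- The conditional expectation `E^λ_𝓑(φ)(ω) = λ(φ_* P_ω)`, where `(P_ω)` is the disintegration of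
`P` with respect to `𝓑`, i.e. the regular conditional probability given `𝓑`. -/
noncomputable def barycentricCondExp {Ω M : Type*} (𝓑 : MeasurableSpace Ω)
    [mΩ : MeasurableSpace Ω] [StandardBorelSpace Ω] [MetricSpace M] [MeasurableSpace M] [Nonempty M]
    (P : Measure[mΩ] Ω) [IsFiniteMeasure P] (φ : Ω → M) : Ω → M :=
  fun ω => canonicalBarycenter (Measure.map φ (condExpKernel P 𝓑 ω))

/-! The functional minimized by `λ` inherits the midpoint convexity of squared distances. Hence the
minimizer b of μ exists, is unique, and satisfies the variance inequality d²(b, z) ≤ ∫ [d²(z, x) -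
d²(b, x)] dμ(x) (`IsCanonicalBarycenter.sq_dist_le`), on which the rest depends.

Take the law of φ under P_ω and z = ψ(ω) with ψ 𝓑-measurable. Both ψ and E^λ(φ) are P_ω-a.s.
constant for a.e. ω, so integrating over ω gives 𝐝₂²(E^λφ, ψ) ≤ 𝐝₂²(φ, ψ) - 𝐝₂²(φ, E^λφ). Thus E^λφ
is the unique 𝐝₂-projection of φ ∈ L².

For L¹, adding the variance inequalities of two laws and using a Cauchy–Schwarz inequality
(`IsGlobalNPC.quasiInner_le`) shows that barycenters are 3/2-Lipschitz; the sharp constant 1 is not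
needed. So E^λ is 𝐝₁-Lipschitz, and since simple functions lie in L² and are dense in L¹, every
continuous extension of the projection equals E^λ. For 𝓑-measurability, the barycenter of a simple
function is Lipschitz in the finitely many weights P_ω(φ = x); general φ follow by a limit. -/

/-! ### Geometry of global NPC spaces: quasi-inner product and convex minimization. -/

section Geometry

variable {M : Type*} [MetricSpace M]

/-- `m` satisfies the midpoint inequality for the pair `x, y`. -/
def IsNPCMidpoint (x y m : M) : Prop :=
  ∀ z : M, dist z m ^ 2 ≤
    (1 / 2) * dist z x ^ 2 + (1 / 2) * dist z y ^ 2 - (1 / 4) * dist x y ^ 2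

theorem IsNPCMidpoint.dist_left_le {x y m : M} (h : IsNPCMidpoint x y m) :
    dist x m ≤ dist x y / 2 := by
  have := h x
  rw [dist_self] at this
  nlinarith [dist_nonneg (x := x) (y := m), dist_nonneg (x := x) (y := y)]

theorem IsNPCMidpoint.dist_right_le {x y m : M} (h : IsNPCMidpoint x y m) :
    dist y m ≤ dist x y / 2 := by
  have := h y
  rw [dist_self, dist_comm y x] at this
  nlinarith [dist_nonneg (x := y) (y := m), dist_nonneg (x := x) (y := y)]

/-- The quadrilateral inequality of a global NPC space. -/
theorem IsGlobalNPC.quadrilateral (hM : IsGlobalNPC M) (a b c d : M) :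
    dist a d ^ 2 + dist b c ^ 2 ≤
      dist a b ^ 2 + dist c d ^ 2 + dist a c ^ 2 + dist b d ^ 2 := by
  obtain ⟨m, hm⟩ := hM.exists_midpoint b c
  have h1 := hm a
  have h2 := hm d
  have h3 := dist_triangle_right a d m
  rw [dist_comm d b, dist_comm d c] at h2
  nlinarith [dist_nonneg (x := a) (y := d), dist_nonneg (x := a) (y := m),
    dist_nonneg (x := d) (y := m), sq_nonneg (dist a m - dist d m)]

/-- Berg–Nikolaev's quasi-inner product of the vectors `a → b` and `c → d`, doubled. -/
noncomputable def quasiInner (a b c d : M) : ℝ :=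
  dist a d ^ 2 + dist b c ^ 2 - dist a c ^ 2 - dist b d ^ 2

theorem quasiInner_comm (a b c d : M) : quasiInner a b c d = quasiInner c d a b := by
  simp only [quasiInner, dist_comm a d, dist_comm b c, dist_comm a c, dist_comm b d]
  ring

/-- The quasi-inner product is additive along a → m → b. Bisecting at a midpoint quarters each d²(a,
b) while using the bound twice, so each step halves the first term and doubles the second. The case
k = 0 is the quadrilateral inequality. -/
theorem IsGlobalNPC.quasiInner_le_dyadic (hM : IsGlobalNPC M) (k : ℕ) (a b c d : M) :
    quasiInner a b c d ≤ dist a b ^ 2 / 2 ^ k + 2 ^ k * dist c d ^ 2 := by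
  induction k generalizing a b with
  | zero =>
    have := hM.quadrilateral a b c d
    simp only [quasiInner]
    linarith
  | succ k ih =>
    obtain ⟨m, hm : IsNPCMidpoint a b m⟩ := hM.exists_midpoint a b
    have h1 := ih a m
    have h2 := ih m b
    have e : quasiInner a b c d = quasiInner a m c d + quasiInner m b c d := by
      simp only [quasiInner]; ring
    have s1 : dist a m ^ 2 ≤ dist a b ^ 2 / 4 := by
      nlinarith [hm.dist_left_le, dist_nonneg (x := a) (y := m)]
    have s2 : dist m b ^ 2 ≤ dist a b ^ 2 / 4 := by
      rw [dist_comm m b]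
      nlinarith [hm.dist_right_le, dist_nonneg (x := b) (y := m)]
    have t1 : dist a m ^ 2 / 2 ^ k ≤ dist a b ^ 2 / 4 / 2 ^ k := by gcongr
    have t2 : dist m b ^ 2 / 2 ^ k ≤ dist a b ^ 2 / 4 / 2 ^ k := by gcongr
    have t3 : dist a b ^ 2 / 2 ^ (k + 1) = 2 * (dist a b ^ 2 / 4 / 2 ^ k) := by
      rw [pow_succ (2 : ℝ) k]; field_simp; norm_num
    rw [e, t3, pow_succ (2 : ℝ) k]
    linarith

theorem IsGlobalNPC.quasiInner_le_of_le (hM : IsGlobalNPC M) {a b c d : M}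
    (h : dist c d ≤ dist a b) : quasiInner a b c d ≤ 3 * dist a b * dist c d := by
  rcases eq_or_lt_of_le (dist_nonneg (x := c) (y := d)) with h0 | h0
  · obtain rfl : c = d := dist_eq_zero.1 h0.symm
    simp [quasiInner]
  -- The ideal weight d(a, b) / d(c, d) is matched by 2 ^ k up to a factor 2: the two terms then
  -- cost at most 2 and 1 times d(a, b) d(c, d).
  · obtain ⟨k, hk1, hk2⟩ := exists_nat_pow_near (x := dist a b / dist c d) (y := 2)
      ((one_le_div h0).2 h) one_lt_two
    rw [le_div_iff₀ h0] at hk1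
    rw [div_lt_iff₀ h0, pow_succ] at hk2
    have h2 : (0 : ℝ) < 2 ^ k := by positivity
    have h3 : dist a b ^ 2 / 2 ^ k ≤ 2 * dist a b * dist c d := by
      rw [div_le_iff₀ h2]
      nlinarith [dist_nonneg (x := a) (y := b)]
    have := hM.quasiInner_le_dyadic k a b c d
    nlinarith

/-- A form of the Cauchy–Schwarz inequality for the quasi-inner product. -/
theorem IsGlobalNPC.quasiInner_le (hM : IsGlobalNPC M) (a b c d : M) :
    quasiInner a b c d ≤ 3 * dist a b * dist c d := by
  rcases le_total (dist c d) (dist a b) with h | h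
  · exact hM.quasiInner_le_of_le h
  · rw [quasiInner_comm]
    have := hM.quasiInner_le_of_le h
    linarith

/-- Functions that are as convex at midpoints as a squared distance. -/
def IsUniformlyMidconvex (F : M → ℝ) : Prop :=
  ∀ x y m : M, IsNPCMidpoint x y m →
    F m ≤ (1 / 2) * F x + (1 / 2) * F y - (1 / 4) * dist x y ^ 2

/-- Bootstrapping: if the bound holds with constant c, applying it at a midpoint of a and z and
inserting midconvexity gives it with (1 + c) / 2. Starting from c = 0, the constants tend to 1. -/
theorem IsUniformlyMidconvex.sq_dist_le_of_forall_le (hM : IsGlobalNPC M) {F : M → ℝ}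
    (hF : IsUniformlyMidconvex F) {a : M} (ha : ∀ z, F a ≤ F z) (z : M) :
    dist a z ^ 2 ≤ F z - F a := by
  have key : ∀ (n : ℕ) (z : M), (1 - (1 / 2) ^ n) * dist a z ^ 2 ≤ F z - F a := by
    intro n
    induction n with
    | zero => intro z; simpa using ha z
    | succ n ih =>
      intro z
      obtain ⟨m, hm : IsNPCMidpoint a z m⟩ := hM.exists_midpoint a z
      have h1 := hF a z m hm
      have h2 := ih m
      have h3 : dist a z / 2 ≤ dist a m := by
        linarith [dist_triangle_right a z m, hm.dist_right_le]
      have h4 : dist a z ^ 2 / 4 ≤ dist a m ^ 2 := by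
        nlinarith [dist_nonneg (x := a) (y := z)]
      have h5 : (0 : ℝ) ≤ 1 - (1 / 2) ^ n :=
        sub_nonneg.2 (pow_le_one₀ (by norm_num) (by norm_num))
      have h6 := mul_le_mul_of_nonneg_left h4 h5
      rw [pow_succ]
      linarith
  have hlim : Tendsto (fun n : ℕ => (1 - (1 / 2 : ℝ) ^ n) * dist a z ^ 2) atTop
      (𝓝 ((1 - 0) * dist a z ^ 2)) :=
    ((tendsto_const_nhds.sub (tendsto_pow_atTop_nhds_zero_of_lt_one (by norm_num)
      (by norm_num))).mul tendsto_const_nhds)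
  have := le_of_tendsto' hlim fun n => key n z
  linarith

/-- The midpoint of two almost-minimizers cannot go below the infimum, so they are close; a
minimizing sequence is Cauchy. -/
theorem IsUniformlyMidconvex.exists_forall_le [Nonempty M] (hM : IsGlobalNPC M) {F : M → ℝ}
    (hF : IsUniformlyMidconvex F) (hc : Continuous F) (hb : BddBelow (Set.range F)) :
    ∃ a, ∀ z, F a ≤ F z := by
  have := hM.complete
  set I := ⨅ z, F z with hI
  have hlow : ∀ z, I ≤ F z := fun z => ciInf_le hb z
  have hex : ∀ n : ℕ, ∃ z, F z < I + (1 / 2) ^ n := fun n =>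
    exists_lt_of_ciInf_lt (lt_add_of_pos_right I (by positivity))
  choose u hu using hex
  have hd : ∀ x y : M, dist x y ^ 2 ≤ 2 * (F x - I) + 2 * (F y - I) := by
    intro x y
    obtain ⟨m, hm : IsNPCMidpoint x y m⟩ := hM.exists_midpoint x y
    have h1 := hF x y m hm
    have h2 := hlow m
    linarith
  have hlim0 : Tendsto (fun n : ℕ => (1 / 2 : ℝ) ^ n) atTop (𝓝 0) :=
    tendsto_pow_atTop_nhds_zero_of_lt_one (by norm_num) (by norm_num)
  have hcau : CauchySeq u := by
    rw [Metric.cauchySeq_iff]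
    intro ε hε
    obtain ⟨N, hN⟩ := (hlim0.eventually (gt_mem_nhds (show 0 < ε ^ 2 / 4 by positivity))).exists
    refine ⟨N, fun m hm n hn => ?_⟩
    have hmono : ∀ k ≥ N, F (u k) - I < ε ^ 2 / 4 := fun k hk => by
      have := pow_le_pow_of_le_one (show (0 : ℝ) ≤ 1 / 2 by norm_num) (by norm_num) hk
      linarith [hu k]
    have := hd (u m) (u n)
    exact lt_of_pow_lt_pow_left₀ 2 hε.le (by linarith [hmono m hm, hmono n hn])
  obtain ⟨a, ha⟩ := cauchySeq_tendsto_of_complete hcau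
  refine ⟨a, fun z => le_trans ?_ (hlow z)⟩
  have h1 : Tendsto (fun n => F (u n)) atTop (𝓝 (F a)) := (hc.tendsto a).comp ha
  have h2 : Tendsto (fun n : ℕ => I + (1 / 2 : ℝ) ^ n) atTop (𝓝 (I + 0)) :=
    tendsto_const_nhds.add hlim0
  simpa using le_of_tendsto_of_tendsto' h1 h2 fun n => (hu n).le

end Geometry

/-! ### Barycenters: existence, uniqueness, variance inequality, Lipschitz bounds. -/

section Barycenter

theorem abs_sq_dist_sub_sq_dist_le {M : Type*} [MetricSpace M] (z y x : M) :
    |dist z x ^ 2 - dist y x ^ 2| ≤ dist z y * (dist z x + dist y x) := by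
  rw [show dist z x ^ 2 - dist y x ^ 2 = (dist z x - dist y x) * (dist z x + dist y x) by ring,
    abs_mul, abs_of_nonneg (show 0 ≤ dist z x + dist y x by positivity)]
  gcongr
  exact abs_dist_sub_le z y x

variable {M : Type*} [MetricSpace M] [MeasurableSpace M] [BorelSpace M]

theorem integrable_dist_of_integrable_dist {μ : Measure M} [IsFiniteMeasure μ] {x₀ : M}
    (h : Integrable (fun y => dist x₀ y) μ) (x : M) : Integrable (fun y => dist x y) μ := by
  refine ((integrable_const (dist x x₀)).add h).mono'
    (by fun_prop) (ae_of_all _ fun y => ?_)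
  rw [Real.norm_of_nonneg dist_nonneg]
  exact dist_triangle _ _ _

theorem integrable_sq_dist_sub {μ : Measure M} [IsFiniteMeasure μ] {x₀ : M}
    (h : Integrable (fun y => dist x₀ y) μ) (z y : M) :
    Integrable (fun x => dist z x ^ 2 - dist y x ^ 2) μ := by
  refine (((integrable_dist_of_integrable_dist h z).add
    (integrable_dist_of_integrable_dist h y)).const_mul (dist z y)).mono'
    (by fun_prop) (ae_of_all _ fun x => abs_sq_dist_sub_sq_dist_le z y x)

theorem isUniformlyMidconvex_integral {μ : Measure M} [IsProbabilityMeasure μ] {x₀ : M}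
    (h : Integrable (fun y => dist x₀ y) μ) (y : M) :
    IsUniformlyMidconvex fun z => ∫ x, (dist z x ^ 2 - dist y x ^ 2) ∂μ := by
  intro a b m hm
  have i := fun z => integrable_sq_dist_sub h z y
  calc ∫ x, (dist m x ^ 2 - dist y x ^ 2) ∂μ
      ≤ ∫ x, ((1 / 2) * (dist a x ^ 2 - dist y x ^ 2) + (1 / 2) * (dist b x ^ 2 - dist y x ^ 2)
          - (1 / 4) * dist a b ^ 2) ∂μ := by
        refine integral_mono (i m)
          ((((i a).const_mul _).add ((i b).const_mul _)).sub (integrable_const _)) fun x => ?_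
        have := hm x
        simp only [dist_comm x] at this
        linarith
    _ = _ := by
        have e1 : ∫ x, ((1 / 2) * (dist a x ^ 2 - dist y x ^ 2) +
            (1 / 2) * (dist b x ^ 2 - dist y x ^ 2)) ∂μ = _ :=
          integral_add ((i a).const_mul _) ((i b).const_mul _)
        have e2 := integral_sub (((i a).const_mul (1 / 2)).add ((i b).const_mul (1 / 2)))
          (integrable_const ((1 / 4) * dist a b ^ 2))
        simp only [Pi.add_apply] at e2
        rw [e2, e1, integral_const_mul, integral_const_mul]
        simp

/-- Changing the base point shifts the functional by a constant, so minimizers do not depend on it.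
-/
theorem integral_sq_dist_sub_sub {μ : Measure M} [IsFiniteMeasure μ] {x₀ : M}
    (h : Integrable (fun y => dist x₀ y) μ) (y z w : M) :
    ∫ x, (dist z x ^ 2 - dist y x ^ 2) ∂μ - ∫ x, (dist w x ^ 2 - dist y x ^ 2) ∂μ =
      ∫ x, (dist z x ^ 2 - dist w x ^ 2) ∂μ := by
  rw [← integral_sub (integrable_sq_dist_sub h z y) (integrable_sq_dist_sub h w y)]
  simp

theorem continuous_integral_sq_dist_sub {μ : Measure M} [IsProbabilityMeasure μ] {x₀ : M}
    (h : Integrable (fun y => dist x₀ y) μ) (y : M) :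
    Continuous fun z => ∫ x, (dist z x ^ 2 - dist y x ^ 2) ∂μ := by
  rw [continuous_iff_continuousAt]
  intro w
  rw [ContinuousAt, tendsto_iff_dist_tendsto_zero]
  set I := ∫ x, dist w x ∂μ
  have iw := integrable_dist_of_integrable_dist h w
  refine squeeze_zero (fun _ => dist_nonneg) (g := fun z => dist z w * (dist z w + 2 * I))
    (fun z => ?_) ?_
  · rw [Real.dist_eq, integral_sq_dist_sub_sub h, ← Real.norm_eq_abs]
    have i2 : Integrable (fun x => dist z w * (dist z w + 2 * dist w x)) μ :=
      ((integrable_const _).add (iw.const_mul 2)).const_mul _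
    refine (norm_integral_le_of_norm_le i2 (ae_of_all _ fun x => ?_)).trans_eq ?_
    · exact (abs_sq_dist_sub_sq_dist_le z w x).trans
        (mul_le_mul_of_nonneg_left (by linarith [dist_triangle z w x]) dist_nonneg)
    · rw [integral_const_mul, integral_add (integrable_const _) (iw.const_mul 2),
        integral_const_mul]
      simp [I]
  · have : Continuous fun z => dist z w * (dist z w + 2 * I) := by fun_prop
    simpa using this.tendsto w

theorem bddBelow_integral_sq_dist_sub {μ : Measure M} [IsProbabilityMeasure μ] {x₀ : M}
    (h : Integrable (fun y => dist x₀ y) μ) (y : M) :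
    BddBelow (Set.range fun z => ∫ x, (dist z x ^ 2 - dist y x ^ 2) ∂μ) := by
  have iy := integrable_dist_of_integrable_dist h y
  -- The triangle inequality bounds the functional below by t² - 2tI with t = d(z, y) and I = ∫ d(y,
  -- x) dμ; its minimum over t is -I².
  refine ⟨-(∫ x, dist y x ∂μ) ^ 2, ?_⟩
  rintro _ ⟨z, rfl⟩
  have : ∫ x, (dist z y ^ 2 - 2 * dist z y * dist y x) ∂μ ≤
      ∫ x, (dist z x ^ 2 - dist y x ^ 2) ∂μ := by
    refine integral_mono ((integrable_const _).sub (iy.const_mul _))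
      (integrable_sq_dist_sub h z y) fun x => ?_
    have h1 := abs_le.1 (abs_dist_sub_le y z x)
    have h2 := dist_triangle_right z y x
    rw [dist_comm y z] at h1
    have : (dist z y - dist y x) ^ 2 ≤ dist z x ^ 2 := by
      rw [sq_le_sq, abs_of_nonneg (dist_nonneg (x := z) (y := x)), abs_le]
      constructor
      · linarith [dist_triangle_left y x z, dist_comm y z, dist_triangle y z x]
      · linarith
    simp only
    linarith
  rw [integral_sub (integrable_const _) (iy.const_mul _), integral_const_mul] at this
  simp only [integral_const, probReal_univ, one_smul] at this
  nlinarith [sq_nonneg (dist z y - ∫ x, dist y x ∂μ)]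

theorem IsCanonicalBarycenter.sq_dist_le (hM : IsGlobalNPC M) {μ : Measure M}
    [IsProbabilityMeasure μ] {x₀ : M} (h : Integrable (fun y => dist x₀ y) μ) {a : M}
    (ha : IsCanonicalBarycenter μ a) (z : M) :
    dist a z ^ 2 ≤ ∫ x, (dist z x ^ 2 - dist a x ^ 2) ∂μ := by
  rw [← integral_sq_dist_sub_sub h a z a]
  exact (isUniformlyMidconvex_integral h a).sq_dist_le_of_forall_le hM (ha a) z

theorem existsUnique_isCanonicalBarycenter [Nonempty M] (hM : IsGlobalNPC M) {μ : Measure M}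
    [IsProbabilityMeasure μ] {x₀ : M} (h : Integrable (fun y => dist x₀ y) μ) :
    ∃! z : M, IsCanonicalBarycenter μ z := by
  obtain ⟨a, ha⟩ := (isUniformlyMidconvex_integral h x₀).exists_forall_le hM
    (continuous_integral_sq_dist_sub h x₀) (bddBelow_integral_sq_dist_sub h x₀)
  have hba : IsCanonicalBarycenter μ a := fun y z => by
    have h1 := integral_sq_dist_sub_sub h y z a
    have h2 := integral_sq_dist_sub_sub h x₀ z a
    linarith [ha z]
  refine ⟨a, hba, fun b hb => ?_⟩
  have h1 := hba.sq_dist_le hM h b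
  have h2 := hb a a
  have h3 : ∫ x, (dist a x ^ 2 - dist a x ^ 2) ∂μ = 0 := by simp
  have h4 : dist a b ^ 2 = 0 := le_antisymm (by linarith) (sq_nonneg _)
  exact (dist_eq_zero.1 (pow_eq_zero_iff two_ne_zero |>.1 h4)).symm

theorem isCanonicalBarycenter_canonicalBarycenter [Nonempty M] (hM : IsGlobalNPC M)
    {μ : Measure M} [IsProbabilityMeasure μ] {x₀ : M} (h : Integrable (fun y => dist x₀ y) μ) :
    IsCanonicalBarycenter μ (canonicalBarycenter μ) :=
  Classical.epsilon_spec (existsUnique_isCanonicalBarycenter hM h).exists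

theorem canonicalBarycenter_dirac [Nonempty M] (hM : IsGlobalNPC M) (x : M) :
    canonicalBarycenter (Measure.dirac x) = x := by
  have h : Integrable (fun y => dist x y) (Measure.dirac x) :=
    integrable_dirac (by simp)
  refine (existsUnique_isCanonicalBarycenter hM h).unique
    (isCanonicalBarycenter_canonicalBarycenter hM h) fun y z => ?_
  simp only [integral_dirac, dist_self]
  nlinarith [sq_nonneg (dist z x)]

section Map

variable {Ω : Type*} {mΩ : MeasurableSpace Ω} {Q : Measure Ω}

theorem integrable_dist_map {f : Ω → M} (hf : AEMeasurable f Q) {x : M}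
    (hi : Integrable (fun ω => dist x (f ω)) Q) :
    Integrable (fun y => dist x y) (Q.map f) :=
  (integrable_map_measure (by fun_prop) hf).2 hi

variable [Nonempty M]

/-- The variance inequality for the barycenter of the law of `f`. -/
theorem sq_dist_canonicalBarycenter_map_le (hM : IsGlobalNPC M) [IsProbabilityMeasure Q]
    {f : Ω → M} (hf : AEMeasurable f Q) {x₀ : M}
    (hi : Integrable (fun ω => dist x₀ (f ω)) Q) (z : M) :
    Integrable (fun ω => dist z (f ω) ^ 2 - dist (canonicalBarycenter (Q.map f)) (f ω) ^ 2) Q ∧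
    dist (canonicalBarycenter (Q.map f)) z ^ 2 ≤
      ∫ ω, (dist z (f ω) ^ 2 - dist (canonicalBarycenter (Q.map f)) (f ω) ^ 2) ∂Q := by
  have := Measure.isProbabilityMeasure_map hf
  have h := integrable_dist_map hf hi
  have h1 := (isCanonicalBarycenter_canonicalBarycenter hM h).sq_dist_le hM h z
  rw [integral_map hf (by fun_prop)] at h1
  exact ⟨(integrable_map_measure (by fun_prop) hf).1 (integrable_sq_dist_sub h z _), h1⟩

/-- Lipschitz continuity of the barycenter of the law of a random variable. -/
theorem dist_canonicalBarycenter_map_le (hM : IsGlobalNPC M) [IsProbabilityMeasure Q]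
    {f g : Ω → M} (hf : AEMeasurable f Q) (hg : AEMeasurable g Q) {x₀ x₁ : M}
    (hfi : Integrable (fun ω => dist x₀ (f ω)) Q) (hgi : Integrable (fun ω => dist x₁ (g ω)) Q)
    (hfg : Integrable (fun ω => dist (f ω) (g ω)) Q) :
    dist (canonicalBarycenter (Q.map f)) (canonicalBarycenter (Q.map g)) ≤
      3 / 2 * ∫ ω, dist (f ω) (g ω) ∂Q := by
  set a := canonicalBarycenter (Q.map f) with ha
  set b := canonicalBarycenter (Q.map g) with hb
  obtain ⟨i1, h1⟩ := sq_dist_canonicalBarycenter_map_le hM hf hfi b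
  obtain ⟨i2, h2⟩ := sq_dist_canonicalBarycenter_map_le hM hg hgi a
  rw [← ha] at i1 h1
  rw [← hb] at i2 h2
  -- The summed integrand is the quasi-inner product of a → b and f ω → g ω. The left side is at
  -- least 2 d²(a, b), whence 3/2.
  have h3 : ∫ ω, (dist b (f ω) ^ 2 - dist a (f ω) ^ 2) ∂Q +
      ∫ ω, (dist a (g ω) ^ 2 - dist b (g ω) ^ 2) ∂Q ≤
      3 * dist a b * ∫ ω, dist (f ω) (g ω) ∂Q := by
    rw [← integral_add i1 i2, ← integral_const_mul]
    refine integral_mono (i1.add i2) (hfg.const_mul _) fun ω => ?_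
    have := hM.quasiInner_le a b (f ω) (g ω)
    simp only [quasiInner] at this
    simp only
    linarith
  rw [dist_comm b a] at h2
  rcases eq_or_lt_of_le (dist_nonneg (x := a) (y := b)) with h0 | h0
  · rw [← h0]
    have : 0 ≤ ∫ ω, dist (f ω) (g ω) ∂Q := integral_nonneg fun _ => dist_nonneg
    positivity
  · nlinarith

theorem dist_canonicalBarycenter_map_const_le (hM : IsGlobalNPC M) [IsProbabilityMeasure Q]
    {f : Ω → M} (hf : AEMeasurable f Q) {x : M} (hi : Integrable (fun ω => dist x (f ω)) Q) :
    dist x (canonicalBarycenter (Q.map f)) ≤ 3 / 2 * ∫ ω, dist x (f ω) ∂Q := by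
  have h := dist_canonicalBarycenter_map_le hM (g := f) (f := fun _ => x) (x₀ := x)
    aemeasurable_const hf (by simp) hi hi
  rwa [Measure.map_const, measure_univ, one_smul, canonicalBarycenter_dirac hM] at h

end Map

end Barycenter

/-! ### 𝓑-measurability for simple functions. -/

section Measurability

/-- Such an f factors through a Lipschitz map on the range of w, which is second countable; hence Y
need not be separable. -/
theorem MeasureTheory.StronglyMeasurable.of_dist_le_mul {α X Y : Type*} [MeasurableSpace α]
    [MetricSpace X] [MetricSpace Y] [MeasurableSpace X] [BorelSpace X]
    [SecondCountableTopology X] {w : α → X} {f : α → Y}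
    (hw : Measurable w) (C : NNReal) (h : ∀ a b, dist (f a) (f b) ≤ C * dist (w a) (w b)) :
    StronglyMeasurable f := by
  choose c hc using fun r : Set.range w => r.2
  have hcont : Continuous fun r : Set.range w => f (c r) := by
    refine (LipschitzWith.of_dist_le_mul (K := C) fun r s => ?_).continuous
    refine (h _ _).trans_eq ?_
    rw [hc, hc]
    rfl
  have hf : f = (fun r : Set.range w => f (c r)) ∘ fun a => (⟨w a, Set.mem_range_self a⟩) := by
    funext a
    refine (dist_le_zero.1 ((h _ _).trans_eq ?_))
    simp [hc]
  rw [hf]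
  exact hcont.comp_stronglyMeasurable (Measurable.subtype_mk hw).stronglyMeasurable

theorem MeasureTheory.SimpleFunc.integral_comp_eq_sum {Ω M : Type*} {mΩ : MeasurableSpace Ω}
    (φ : SimpleFunc Ω M) (Q : Measure Ω) [IsFiniteMeasure Q] (f : M → ℝ) :
    ∫ ω, f (φ ω) ∂Q = ∑ x ∈ φ.range, Q.real (φ ⁻¹' {x}) * f x := by
  classical
  have e : (fun ω => f (φ ω)) =
      fun ω => ∑ x ∈ φ.range, (φ ⁻¹' {x}).indicator (fun _ => f x) ω := by
    funext ω
    rw [Finset.sum_eq_single (φ ω)]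
    · simp
    · intro x _ hx
      simp [Set.indicator, hx.symm]
    · intro h
      exact absurd (φ.mem_range_self ω) h
  rw [e, integral_finsetSum]
  · refine Finset.sum_congr rfl fun x _ => ?_
    rw [integral_indicator_const _ (φ.measurableSet_fiber x), smul_eq_mul]
  · exact fun x _ => (integrable_const _).indicator (φ.measurableSet_fiber x)

variable {Ω M : Type*} [MetricSpace M]

theorem MeasureTheory.SimpleFunc.exists_dist_le {mΩ : MeasurableSpace Ω} (φ : SimpleFunc Ω M) :
    ∃ D : ℝ, 0 ≤ D ∧ ∀ a b, dist (φ a) (φ b) ≤ D := by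
  have hb := φ.finite_range.isBounded
  exact ⟨Metric.diam (Set.range φ), Metric.diam_nonneg, fun a b =>
    Metric.dist_le_diam_of_mem hb (Set.mem_range_self a) (Set.mem_range_self b)⟩

theorem MeasureTheory.SimpleFunc.integrable_dist {mΩ : MeasurableSpace Ω} (φ : SimpleFunc Ω M)
    (Q : Measure Ω) [IsFiniteMeasure Q] (x : M) : Integrable (fun ω => dist x (φ ω)) Q :=
  SimpleFunc.integrable_of_isFiniteMeasure (φ.map (dist x))

variable [MeasurableSpace M] [BorelSpace M]

variable [Nonempty M]

/-- The barycenter of the law of a simple function depends on the underlying probability measure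
in a Lipschitz way. -/
theorem exists_dist_canonicalBarycenter_simpleFunc_le (hM : IsGlobalNPC M)
    {mΩ : MeasurableSpace Ω} (φ : SimpleFunc Ω M) :
    ∃ C : ℝ, 0 ≤ C ∧ ∀ (Q Q' : Measure Ω) [IsProbabilityMeasure Q] [IsProbabilityMeasure Q'],
      dist (canonicalBarycenter (Q.map φ)) (canonicalBarycenter (Q'.map φ)) ≤
        C * ∑ x ∈ φ.range, |Q.real (φ ⁻¹' {x}) - Q'.real (φ ⁻¹' {x})| := by
  obtain ⟨D, hD0, hD⟩ := φ.exists_dist_le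
  have hR : ∀ (Q : Measure Ω) [IsProbabilityMeasure Q], ∀ x ∈ φ.range,
      dist (canonicalBarycenter (Q.map φ)) x ≤ 3 / 2 * D := by
    intro Q _ x hx
    obtain ⟨ω₀, rfl⟩ := SimpleFunc.mem_range.1 hx
    rw [dist_comm]
    refine (dist_canonicalBarycenter_map_const_le hM φ.measurable.aemeasurable
      (φ.integrable_dist Q _)).trans ?_
    gcongr
    refine (integral_mono (φ.integrable_dist Q _) (integrable_const D) fun ω => hD _ _).trans ?_
    simp
  refine ⟨3 / 2 * D, by positivity, fun Q Q' _ _ => ?_⟩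
  set a := canonicalBarycenter (Q.map φ) with ha
  set b := canonicalBarycenter (Q'.map φ) with hb
  have h1 := (sq_dist_canonicalBarycenter_map_le hM φ.measurable.aemeasurable
    (φ.integrable_dist Q a) b).2
  have h2 := (sq_dist_canonicalBarycenter_map_le hM φ.measurable.aemeasurable
    (φ.integrable_dist Q' a) a).2
  rw [← ha, φ.integral_comp_eq_sum Q fun x => dist b x ^ 2 - dist a x ^ 2] at h1
  rw [← hb, φ.integral_comp_eq_sum Q' fun x => dist a x ^ 2 - dist b x ^ 2, dist_comm b a] at h2
  -- The two integrands are opposite, so only differences of weights survive. Both barycenters lie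
  -- within 3D/2 of every value of φ, which gives the factor 3D.
  have h3 : ∑ x ∈ φ.range, Q.real (φ ⁻¹' {x}) * (dist b x ^ 2 - dist a x ^ 2) +
      ∑ x ∈ φ.range, Q'.real (φ ⁻¹' {x}) * (dist a x ^ 2 - dist b x ^ 2) ≤
      dist a b * (3 * D) * ∑ x ∈ φ.range, |Q.real (φ ⁻¹' {x}) - Q'.real (φ ⁻¹' {x})| := by
    rw [← Finset.sum_add_distrib, Finset.mul_sum]
    refine Finset.sum_le_sum fun x hx => ?_
    have h4 := abs_sq_dist_sub_sq_dist_le b a x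
    have h5 : |dist b x ^ 2 - dist a x ^ 2| ≤ dist a b * (3 * D) := by
      rw [dist_comm b a] at h4
      refine h4.trans (mul_le_mul_of_nonneg_left ?_ dist_nonneg)
      have := hR Q x hx
      have := hR Q' x hx
      linarith
    calc _ = (Q.real (φ ⁻¹' {x}) - Q'.real (φ ⁻¹' {x})) * (dist b x ^ 2 - dist a x ^ 2) := by ring
      _ ≤ |Q.real (φ ⁻¹' {x}) - Q'.real (φ ⁻¹' {x})| * |dist b x ^ 2 - dist a x ^ 2| := by
        rw [← abs_mul]; exact le_abs_self _
      _ ≤ |Q.real (φ ⁻¹' {x}) - Q'.real (φ ⁻¹' {x})| * (dist a b * (3 * D)) := by gcongr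
      _ = _ := by ring
  rcases eq_or_lt_of_le (dist_nonneg (x := a) (y := b)) with h0 | h0
  · rw [← h0]
    positivity
  · nlinarith

theorem stronglyMeasurable_barycentricCondExp_simpleFunc (hM : IsGlobalNPC M)
    {𝓑 : MeasurableSpace Ω} [mΩ : MeasurableSpace Ω] [StandardBorelSpace Ω]
    (P : Measure[mΩ] Ω) [IsFiniteMeasure P] (φ : SimpleFunc Ω M) :
    StronglyMeasurable[𝓑] (barycentricCondExp 𝓑 P φ) := by
  obtain ⟨C, hC, h⟩ := exists_dist_canonicalBarycenter_simpleFunc_le hM φ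
  refine @StronglyMeasurable.of_dist_le_mul Ω (φ.range → ℝ) M 𝓑 _ _ _ _ _
    (fun ω x => (condExpKernel P 𝓑 ω).real (φ ⁻¹' {x.1})) _ ?_
    (C.toNNReal * φ.range.card) fun a b => ?_
  · refine @measurable_pi_lambda _ _ _ 𝓑 _ _ fun x => ?_
    exact (measurable_condExpKernel (φ.measurableSet_fiber x.1)).ennreal_toReal
  · refine (h (condExpKernel P 𝓑 a) (condExpKernel P 𝓑 b)).trans ?_
    rw [NNReal.coe_mul, Real.coe_toNNReal C hC, mul_assoc]
    refine mul_le_mul_of_nonneg_left ?_ hC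
    rw [← Finset.sum_coe_sort]
    -- Weight vectors carry the sup distance, so the sum of differences costs a factor equal to the
    -- number of values.
    refine (Finset.sum_le_card_nsmul _ _
      (dist (fun x : φ.range => (condExpKernel P 𝓑 a).real (φ ⁻¹' {x.1}))
        (fun x : φ.range => (condExpKernel P 𝓑 b).real (φ ⁻¹' {x.1}))) fun x _ => ?_).trans_eq ?_
    · exact dist_le_pi_dist (fun x : φ.range => (condExpKernel P 𝓑 a).real (φ ⁻¹' {x.1}))
        (fun x : φ.range => (condExpKernel P 𝓑 b).real (φ ⁻¹' {x.1})) x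
    · simp

end Measurability

/-! ### Disintegration: null sets, integrals and 𝓑-measurable maps. -/

section CondExpKernel

theorem MeasureTheory.StronglyMeasurable.exists_seq_finite_range {α β : Type*} {m : MeasurableSpace α}
    [TopologicalSpace β] {f : α → β} (hf : StronglyMeasurable f) :
    ∃ fs : ℕ → α → β, (∀ n x, MeasurableSet (fs n ⁻¹' {x})) ∧ (∀ n, (Set.range (fs n)).Finite) ∧
      ∀ a, Tendsto (fun n => fs n a) atTop (𝓝 (f a)) :=
  ⟨fun n => hf.approx n, fun n => (hf.approx n).measurableSet_fiber,
    fun n => (hf.approx n).finite_range, hf.tendsto_approx⟩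

variable {Ω M : Type*} {𝓑 : MeasurableSpace Ω} [mΩ : MeasurableSpace Ω] [StandardBorelSpace Ω]
  {P : Measure[mΩ] Ω} [IsFiniteMeasure P]

theorem ae_trim_ae_condExpKernel (h𝓑 : 𝓑 ≤ mΩ) {p : Ω → Prop} (hp : ∀ᵐ ω ∂P, p ω) :
    ∀ᵐ ω ∂(P.trim h𝓑), ∀ᵐ ω' ∂(condExpKernel P 𝓑 ω), p ω' := by
  refine Measure.ae_ae_of_ae_comp ?_
  rwa [condExpKernel_comp_trim h𝓑]

theorem ae_ae_condExpKernel (h𝓑 : 𝓑 ≤ mΩ) {p : Ω → Prop} (hp : ∀ᵐ ω ∂P, p ω) :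
    ∀ᵐ ω ∂P, ∀ᵐ ω' ∂(condExpKernel P 𝓑 ω), p ω' :=
  ae_of_ae_trim h𝓑 (ae_trim_ae_condExpKernel h𝓑 hp)

theorem integral_integral_condExpKernel (h𝓑 : 𝓑 ≤ mΩ) {f : Ω → ℝ} (hf : Integrable f P) :
    ∫ ω, ∫ ω', f ω' ∂(condExpKernel P 𝓑 ω) ∂P = ∫ ω, f ω ∂P := by
  rw [← integral_condExp h𝓑 (f := f)]
  exact integral_congr_ae (condExp_ae_eq_integral_condExpKernel h𝓑 hf).symm

/-- For s in 𝓑, P_ω(sᶜ) is a.e. the conditional expectation of the indicator of sᶜ, which is that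
indicator itself. -/
theorem ae_condExpKernel_mem_of_mem (h𝓑 : 𝓑 ≤ mΩ) {s : Set Ω} (hs : MeasurableSet[𝓑] s) :
    ∀ᵐ ω ∂P, ω ∈ s → ∀ᵐ ω' ∂(condExpKernel P 𝓑 ω), ω' ∈ s := by
  have h1 := condExpKernel_ae_eq_condExp (μ := P) h𝓑 (h𝓑 _ hs.compl)
  rw [condExp_of_stronglyMeasurable h𝓑 (stronglyMeasurable_const.indicator hs.compl)
    ((integrable_const _).indicator (h𝓑 _ hs.compl))] at h1
  filter_upwards [h1] with ω hω hmem
  rw [Set.indicator_of_notMem (by simpa using hmem), measureReal_eq_zero_iff] at hω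
  exact hω

variable [MetricSpace M]

/-- Finitely valued approximants have countably many level sets in all, so one null set serves for
all of them; then pass to the limit. -/
theorem MeasureTheory.StronglyMeasurable.ae_condExpKernel_eq (h𝓑 : 𝓑 ≤ mΩ) {ψ : Ω → M}
    (hψ : StronglyMeasurable[𝓑] ψ) :
    ∀ᵐ ω ∂P, ∀ᵐ ω' ∂(condExpKernel P 𝓑 ω), ψ ω' = ψ ω := by
  obtain ⟨fs, hm, hfin, hlim⟩ := hψ.exists_seq_finite_range
  have h : ∀ᵐ ω ∂P, ∀ n, ∀ x ∈ Set.range (fs n),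
      fs n ω = x → ∀ᵐ ω' ∂(condExpKernel P 𝓑 ω), fs n ω' = x :=
    ae_all_iff.2 fun n => (ae_ball_iff (hfin n).countable).2 fun x _ =>
      ae_condExpKernel_mem_of_mem h𝓑 (hm n x)
  filter_upwards [h] with ω hω
  have h2 : ∀ᵐ ω' ∂(condExpKernel P 𝓑 ω), ∀ n, fs n ω' = fs n ω :=
    ae_all_iff.2 fun n => hω n _ (Set.mem_range_self _) rfl
  filter_upwards [h2] with ω' h3
  refine tendsto_nhds_unique (hlim ω') ?_
  simp only [h3]
  exact hlim ω

theorem MeasureTheory.AEStronglyMeasurable.ae_condExpKernel_eq (h𝓑 : 𝓑 ≤ mΩ) {ψ : Ω → M}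
    (hψ : AEStronglyMeasurable[𝓑] ψ P) :
    ∀ᵐ ω ∂P, ∀ᵐ ω' ∂(condExpKernel P 𝓑 ω), ψ ω' = ψ ω := by
  obtain ⟨g, hg, hgψ⟩ := hψ
  filter_upwards [StronglyMeasurable.ae_condExpKernel_eq (P := P) h𝓑 hg,
    ae_ae_condExpKernel h𝓑 hgψ, hgψ] with ω h1 h2 h3
  filter_upwards [h1, h2] with ω' h4 h5
  rw [h5, h4, h3]

end CondExpKernel

/-! ### Concentration on the support without separability of M. -/

section Support

/-- A measure concentrated on a separable set is concentrated on its support. -/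
theorem MeasureTheory.Measure.measure_compl_support_of_isSeparable {X : Type*}
    [PseudoMetricSpace X] [MeasurableSpace X] {μ : Measure X} {s : Set X}
    (hs : TopologicalSpace.IsSeparable s) (h : ∀ᵐ x ∂μ, x ∈ s) : μ μ.supportᶜ = 0 := by
  have hsep : TopologicalSpace.IsSeparable (μ.supportᶜ ∩ s) := hs.mono Set.inter_subset_right
  have hL : IsLindelof (μ.supportᶜ ∩ s) := by
    have := hsep.secondCountableTopology
    rw [isLindelof_iff_lindelofSpace]
    infer_instance
  have h0 : (μ.supportᶜ ∩ s)ᶜ ∈ ae μ := by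
    -- Points off the support have null neighbourhoods; by the Lindelöf property countably many of
    -- them cover.
    refine hL.compl_mem_sets_of_nhdsWithin fun x hx => ?_
    obtain ⟨U, hU, hU0⟩ := Measure.notMem_support_iff_exists.1 hx.1
    exact ⟨U, mem_nhdsWithin_of_mem_nhds hU, compl_mem_ae_iff.2 hU0⟩
  change μ.support ∈ ae μ
  filter_upwards [h0, h] with x h1 h2
  by_contra h3
  exact h1 ⟨h3, h2⟩

end Support

/-! ### The spaces L^p(Ω; M) and density of simple functions. -/

section MemLpMetric

variable {Ω M : Type*} {𝓑 : MeasurableSpace Ω} [mΩ : MeasurableSpace Ω] {P : Measure[mΩ] Ω}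
  [MetricSpace M] {p : ℝ≥0∞} {φ ψ : Ω → M}

theorem MemLpMetric.of_memLp (h : AEStronglyMeasurable[𝓑] φ P) {x : M}
    (hx : MemLp (fun ω => dist x (φ ω)) p P) : MemLpMetric 𝓑 p P φ :=
  ⟨h, x, hx.2⟩

theorem MemLpMetric.of_le (h𝓑 : 𝓑 ≤ mΩ) (h : MemLpMetric 𝓑 p P φ) : MemLpMetric mΩ p P φ :=
  ⟨h.1.mono h𝓑, h.2⟩

theorem MemLpMetric.memLp_dist_const [IsFiniteMeasure P] (h : MemLpMetric mΩ p P φ) (y : M) :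
    MemLp (fun ω => dist y (φ ω)) p P := by
  obtain ⟨hm, x, hx⟩ := h
  have h1 : MemLp (fun ω => dist x (φ ω)) p P := ⟨aestronglyMeasurable_const.dist hm, hx⟩
  refine ((memLp_const (dist y x)).add h1).mono (aestronglyMeasurable_const.dist hm)
    (ae_of_all _ fun ω => ?_)
  rw [Real.norm_of_nonneg dist_nonneg]
  exact (dist_triangle _ _ _).trans (le_abs_self _)

theorem MemLpMetric.memLp_dist [IsFiniteMeasure P] (h : MemLpMetric mΩ p P φ)
    (h' : MemLpMetric mΩ p P ψ) : MemLp (fun ω => dist (φ ω) (ψ ω)) p P := by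
  obtain ⟨x, -⟩ := h.2
  refine ((h.memLp_dist_const x).add (h'.memLp_dist_const x)).mono (h.1.dist h'.1)
    (ae_of_all _ fun ω => ?_)
  rw [Real.norm_of_nonneg dist_nonneg]
  exact (dist_triangle_left _ _ _).trans (le_abs_self _)

theorem MemLpMetric.integrable_dist_const [IsFiniteMeasure P] (h : MemLpMetric mΩ 1 P φ) (y : M) :
    Integrable (fun ω => dist y (φ ω)) P :=
  memLp_one_iff_integrable.1 (h.memLp_dist_const y)

theorem MemLpMetric.integrable_dist [IsFiniteMeasure P] (h : MemLpMetric mΩ 1 P φ)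
    (h' : MemLpMetric mΩ 1 P ψ) : Integrable (fun ω => dist (φ ω) (ψ ω)) P :=
  memLp_one_iff_integrable.1 (h.memLp_dist h')

theorem MemLpMetric.mono_exponent [IsFiniteMeasure P] {q : ℝ≥0∞} (h : MemLpMetric mΩ q P φ)
    (hpq : p ≤ q) : MemLpMetric mΩ p P φ := by
  obtain ⟨x, -⟩ := h.2
  exact .of_memLp h.1 ((h.memLp_dist_const x).mono_exponent hpq)

theorem distLp_one_eq (h : Integrable (fun ω => dist (φ ω) (ψ ω)) P) :
    distLp 1 P φ ψ = ENNReal.ofReal (∫ ω, dist (φ ω) (ψ ω) ∂P) := by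
  rw [distLp, eLpNorm_one_eq_lintegral_enorm, ← ofReal_integral_norm_eq_lintegral_enorm h]
  simp

theorem distLp_two_le_iff {φ' ψ' : Ω → M} (h : MemLp (fun ω => dist (φ ω) (ψ ω)) 2 P)
    (h' : MemLp (fun ω => dist (φ' ω) (ψ' ω)) 2 P) :
    distLp 2 P φ ψ ≤ distLp 2 P φ' ψ' ↔
      ∫ ω, dist (φ ω) (ψ ω) ^ 2 ∂P ≤ ∫ ω, dist (φ' ω) (ψ' ω) ^ 2 ∂P := by
  rw [distLp, distLp, h.eLpNorm_eq_integral_rpow_norm two_ne_zero ENNReal.ofNat_ne_top,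
    h'.eLpNorm_eq_integral_rpow_norm two_ne_zero ENNReal.ofNat_ne_top,
    ENNReal.ofReal_le_ofReal_iff (by positivity), Real.rpow_le_rpow_iff (by positivity)
      (by positivity) (by norm_num)]
  simp

theorem ae_eq_of_distLp_one_eq_zero (hφ : AEStronglyMeasurable φ P)
    (hψ : AEStronglyMeasurable ψ P) (h : distLp 1 P φ ψ = 0) : φ =ᵐ[P] ψ := by
  rw [distLp, eLpNorm_eq_zero_iff (hφ.dist hψ) one_ne_zero] at h
  filter_upwards [h] with ω hω using dist_eq_zero.1 hω

theorem distLp_one_triangle {χ : Ω → M} (hφ : AEStronglyMeasurable φ P)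
    (hχ : AEStronglyMeasurable χ P) (hψ : AEStronglyMeasurable ψ P) :
    distLp 1 P φ ψ ≤ distLp 1 P χ φ + distLp 1 P χ ψ := by
  refine (eLpNorm_mono_real fun ω => ?_).trans
    (eLpNorm_add_le (hχ.dist hφ) (hχ.dist hψ) le_rfl)
  rw [Real.norm_of_nonneg dist_nonneg]
  exact dist_triangle_left _ _ _

/-- Approximation of a strongly measurable map by simple functions. -/
theorem MeasureTheory.StronglyMeasurable.exists_simpleFunc_approx (hφ : StronglyMeasurable φ)
    (x : M) : ∃ φs : ℕ → SimpleFunc Ω M,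
      (∀ n ω, dist (φs n ω) (φ ω) ≤ dist x (φ ω)) ∧
      ∀ ω, Tendsto (fun n => dist (φs n ω) (φ ω)) atTop (𝓝 0) := by
  borelize M
  -- With x adjoined as the default value, no approximant is farther from φ than x is: this is the
  -- domination used later.
  have hs : TopologicalSpace.IsSeparable (insert x (Set.range φ)) := by
    rw [Set.insert_eq]
    exact (Set.countable_singleton x).isSeparable.union hφ.isSeparable_range
  have : TopologicalSpace.SeparableSpace ↥(insert x (Set.range φ)) := hs.separableSpace
  refine ⟨SimpleFunc.approxOn φ hφ.measurable (insert x (Set.range φ)) x (Set.mem_insert _ _), fun n ω => ?_,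
    fun ω => ?_⟩
  · have := SimpleFunc.edist_approxOn_le hφ.measurable (Set.mem_insert x (Set.range φ)) ω n
    rwa [edist_dist, edist_dist, ENNReal.ofReal_le_ofReal_iff dist_nonneg] at this
  · rw [← tendsto_iff_dist_tendsto_zero]
    exact SimpleFunc.tendsto_approxOn hφ.measurable (Set.mem_insert x (Set.range φ))
      (subset_closure (Set.mem_insert_of_mem _ (Set.mem_range_self ω)))

theorem memLpMetric_simpleFunc [IsFiniteMeasure P] [Nonempty M] (φ : SimpleFunc Ω M) :
    MemLpMetric mΩ p P φ :=
  let x := Classical.arbitrary M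
  .of_memLp (x := x) φ.stronglyMeasurable.aestronglyMeasurable
    ((φ.map (dist x)).memLp_of_isFiniteMeasure p P)

/-- Dominated convergence, needed both for P and for the kernels P_ω. -/
theorem tendsto_integral_dist_of_le {φs : ℕ → Ω → M} {x : M}
    (hφs : ∀ n, AEStronglyMeasurable (φs n) P) (hφ : AEStronglyMeasurable φ P)
    (hi : Integrable (fun ω => dist x (φ ω)) P)
    (hle : ∀ n, ∀ᵐ ω ∂P, dist (φs n ω) (φ ω) ≤ dist x (φ ω))
    (hlim : ∀ᵐ ω ∂P, Tendsto (fun n => dist (φs n ω) (φ ω)) atTop (𝓝 0)) :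
    Tendsto (fun n => ∫ ω, dist (φs n ω) (φ ω) ∂P) atTop (𝓝 0) := by
  have := tendsto_integral_of_dominated_convergence (F := fun n ω => dist (φs n ω) (φ ω))
    (f := fun _ => (0 : ℝ)) _ (fun n => (hφs n).dist hφ) hi
    (fun n => by simpa [Real.norm_of_nonneg dist_nonneg] using hle n) hlim
  simpa using this

/-- Simple functions are `𝐝₁`-dense in `L¹`. -/
theorem MemLpMetric.exists_simpleFunc_tendsto [IsFiniteMeasure P] [Nonempty M]
    (h : MemLpMetric mΩ 1 P φ) : ∃ φs : ℕ → SimpleFunc Ω M,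
      Tendsto (fun n => distLp 1 P (φs n) φ) atTop (𝓝 0) := by
  obtain ⟨φ', hφ', hae⟩ := h.1
  let x := Classical.arbitrary M
  obtain ⟨φs, hle, hlim⟩ := hφ'.exists_simpleFunc_approx x
  refine ⟨φs, ?_⟩
  have key := tendsto_integral_dist_of_le (P := P) (φs := fun n => φs n) (x := x)
    (fun n => (φs n).stronglyMeasurable.aestronglyMeasurable) h.1 (h.integrable_dist_const x)
    (fun n => hae.mono fun ω hω => by rw [hω]; exact hle n ω)
    (hae.mono fun ω hω => by rw [hω]; exact hlim ω)
  have := ENNReal.tendsto_ofReal key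
  rw [ENNReal.ofReal_zero] at this
  refine this.congr fun n => (distLp_one_eq ?_).symm
  exact (memLpMetric_simpleFunc (φs n)).integrable_dist h

end MemLpMetric

/-! ### Measurability and integrability under P_ω. -/

section Disintegration

theorem stronglyMeasurable_limUnder {Ω M : Type*} {m : MeasurableSpace Ω} [MetricSpace M]
    [CompleteSpace M] [Nonempty M] {f : ℕ → Ω → M} (hf : ∀ n, StronglyMeasurable (f n)) :
    StronglyMeasurable fun ω => limUnder atTop fun n => f n ω :=
  StronglyMeasurable.limUnder hf

variable {Ω M : Type*} {𝓑 : MeasurableSpace Ω} [mΩ : MeasurableSpace Ω] [StandardBorelSpace Ω]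
  {P : Measure[mΩ] Ω} [IsFiniteMeasure P] [MetricSpace M] {φ ψ : Ω → M}

theorem MeasureTheory.AEStronglyMeasurable.ae_condExpKernel (h𝓑 : 𝓑 ≤ mΩ)
    (hφ : AEStronglyMeasurable φ P) :
    ∀ᵐ ω ∂P, AEStronglyMeasurable φ (condExpKernel P 𝓑 ω) := by
  obtain ⟨g, hg, h⟩ := hφ
  filter_upwards [ae_ae_condExpKernel h𝓑 h] with ω hω using ⟨g, hg, hω⟩

theorem MemLpMetric.ae_integrable_condExpKernel (h𝓑 : 𝓑 ≤ mΩ) (h : MemLpMetric mΩ 1 P φ) :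
    ∀ᵐ ω ∂P, ∀ y, Integrable (fun ω' => dist y (φ ω')) (condExpKernel P 𝓑 ω) := by
  obtain ⟨x, -⟩ := h.2
  filter_upwards [(h.integrable_dist_const x).condExpKernel_ae (m := 𝓑),
    h.1.ae_condExpKernel h𝓑] with ω hx hm y
  refine ((integrable_const (dist y x)).add hx).mono' (aestronglyMeasurable_const.dist hm)
    (ae_of_all _ fun ω' => ?_)
  rw [Real.norm_of_nonneg dist_nonneg]
  exact dist_triangle _ _ _

theorem barycentricCondExp_ae_congr [MeasurableSpace M] [Nonempty M] (h𝓑 : 𝓑 ≤ mΩ)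
    (h : φ =ᵐ[P] ψ) :
    barycentricCondExp 𝓑 P φ =ᵐ[P] barycentricCondExp 𝓑 P ψ := by
  filter_upwards [ae_ae_condExpKernel h𝓑 h] with ω hω
  simp only [barycentricCondExp, Measure.map_congr hω]

end Disintegration

/-! ### The barycentric conditional expectation on L^p. -/

section BarycentricCondExp

variable {Ω M : Type*} {𝓑 : MeasurableSpace Ω} [mΩ : MeasurableSpace Ω] [StandardBorelSpace Ω]
  {P : Measure[mΩ] Ω} [IsProbabilityMeasure P] [MetricSpace M] [MeasurableSpace M] [BorelSpace M]
  {p : ℝ≥0∞} {φ ψ : Ω → M}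

theorem MemLpMetric.ae_memP1 (h𝓑 : 𝓑 ≤ mΩ) (h : MemLpMetric mΩ 1 P φ) :
    ∀ᵐ ω ∂P, MemP1 (Measure.map φ (condExpKernel P 𝓑 ω)) := by
  obtain ⟨x, -⟩ := h.2
  filter_upwards [h.1.ae_condExpKernel h𝓑, h.ae_integrable_condExpKernel h𝓑] with ω hm hi
  refine ⟨Measure.isProbabilityMeasure_map hm.aemeasurable, ?_, x,
    integrable_dist_map hm.aemeasurable (hi x)⟩
  obtain ⟨t, ht, hmem⟩ := hm.isSeparable_ae_range
  refine Measure.measure_compl_support_of_isSeparable ht.closure ?_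
  exact (ae_map_iff hm.aemeasurable (p := (· ∈ closure t)) isClosed_closure.measurableSet).2
    (hmem.mono fun _ hω => subset_closure hω)

variable [Nonempty M]

theorem MemLpMetric.ae_dist_barycentricCondExp_le (hM : IsGlobalNPC M) (h𝓑 : 𝓑 ≤ mΩ)
    (hφ : MemLpMetric mΩ 1 P φ) (hψ : MemLpMetric mΩ 1 P ψ) :
    ∀ᵐ ω ∂P, dist (barycentricCondExp 𝓑 P φ ω) (barycentricCondExp 𝓑 P ψ ω) ≤
      3 / 2 * ∫ ω', dist (φ ω') (ψ ω') ∂(condExpKernel P 𝓑 ω) := by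
  obtain ⟨x, -⟩ := hφ.2
  filter_upwards [hφ.1.ae_condExpKernel h𝓑, hφ.ae_integrable_condExpKernel h𝓑,
    hψ.1.ae_condExpKernel h𝓑, hψ.ae_integrable_condExpKernel h𝓑,
    (hφ.integrable_dist hψ).condExpKernel_ae (m := 𝓑)] with ω h1 h2 h3 h4 h5
  exact dist_canonicalBarycenter_map_le hM h1.aemeasurable h3.aemeasurable (h2 x) (h4 x) h5

/-- The pointwise bound is 3/2 times the real conditional expectation of d(φ, ψ), and conditional
expectation contracts L¹. -/
theorem MemLpMetric.distLp_one_barycentricCondExp_le (hM : IsGlobalNPC M) (h𝓑 : 𝓑 ≤ mΩ)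
    (hφ : MemLpMetric mΩ 1 P φ) (hψ : MemLpMetric mΩ 1 P ψ) :
    distLp 1 P (barycentricCondExp 𝓑 P φ) (barycentricCondExp 𝓑 P ψ) ≤
      ENNReal.ofReal (3 / 2) * distLp 1 P φ ψ := by
  have hi := hφ.integrable_dist hψ
  calc distLp 1 P (barycentricCondExp 𝓑 P φ) (barycentricCondExp 𝓑 P ψ)
      ≤ eLpNorm (fun ω => 3 / 2 * P[fun ω => dist (φ ω) (ψ ω) | 𝓑] ω) 1 P := by
        refine eLpNorm_mono_ae_real ?_
        filter_upwards [hφ.ae_dist_barycentricCondExp_le hM h𝓑 hψ,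
          condExp_ae_eq_integral_condExpKernel h𝓑 hi] with ω h1 h2
        rwa [h2, Real.norm_of_nonneg dist_nonneg]
    _ = ENNReal.ofReal (3 / 2) * eLpNorm (P[fun ω => dist (φ ω) (ψ ω) | 𝓑]) 1 P := by
        rw [← Real.enorm_of_nonneg (by norm_num : (0 : ℝ) ≤ 3 / 2)]
        exact eLpNorm_const_smul (3 / 2 : ℝ) _ _ _
    _ ≤ _ := by
        gcongr
        exact eLpNorm_condExp_le_eLpNorm _ le_rfl

theorem MeasureTheory.StronglyMeasurable.aestronglyMeasurable_barycentricCondExp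
    (hM : IsGlobalNPC M) (h𝓑 : 𝓑 ≤ mΩ) (hφ : StronglyMeasurable φ) (h : MemLpMetric mΩ 1 P φ) :
    AEStronglyMeasurable[𝓑] (barycentricCondExp 𝓑 P φ) P := by
  obtain ⟨x, -⟩ := h.2
  obtain ⟨φs, hle, hlim⟩ := hφ.exists_simpleFunc_approx x
  have := hM.complete
  -- A limit of 𝓑-measurable maps; the junk value where it diverges matters only on a null set.
  refine ⟨fun ω => limUnder atTop fun n => barycentricCondExp 𝓑 P (φs n) ω,
    stronglyMeasurable_limUnder fun n =>
      stronglyMeasurable_barycentricCondExp_simpleFunc hM P _, ?_⟩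
  have hd : ∀ᵐ ω ∂P, ∀ n, dist (barycentricCondExp 𝓑 P (φs n) ω) (barycentricCondExp 𝓑 P φ ω) ≤
      3 / 2 * ∫ ω', dist (φs n ω') (φ ω') ∂(condExpKernel P 𝓑 ω) :=
    ae_all_iff.2 fun n => (memLpMetric_simpleFunc (φs n)).ae_dist_barycentricCondExp_le hM h𝓑 h
  filter_upwards [hd, h.ae_integrable_condExpKernel h𝓑] with ω h1 h2
  refine (Tendsto.limUnder_eq ?_).symm
  rw [tendsto_iff_dist_tendsto_zero]
  refine squeeze_zero (fun _ => dist_nonneg) h1 ?_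
  have := tendsto_integral_dist_of_le (P := condExpKernel P 𝓑 ω) (φs := fun n => φs n) (x := x)
    (fun n => (φs n).stronglyMeasurable.aestronglyMeasurable) hφ.aestronglyMeasurable (h2 x)
    (fun n => ae_of_all _ (hle n)) (ae_of_all _ hlim)
  simpa using this.const_mul (3 / 2)

theorem MemLpMetric.barycentricCondExp (hM : IsGlobalNPC M) (h𝓑 : 𝓑 ≤ mΩ) (hp : 1 ≤ p)
    (h : MemLpMetric mΩ p P φ) : MemLpMetric 𝓑 p P (barycentricCondExp 𝓑 P φ) := by
  have h1 := h.mono_exponent hp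
  obtain ⟨φ', hφ', hae⟩ := h.1
  obtain ⟨x, -⟩ := h.2
  have h1' : MemLpMetric mΩ 1 P φ' :=
    .of_memLp (x := x) hφ'.aestronglyMeasurable ((h1.memLp_dist_const x).ae_eq
      (hae.mono fun ω hω => by simp only [hω]))
  have hm : AEStronglyMeasurable[𝓑] (_root_.barycentricCondExp 𝓑 P φ) P :=
    (hφ'.aestronglyMeasurable_barycentricCondExp hM h𝓑 h1').congr
      (barycentricCondExp_ae_congr h𝓑 hae).symm
  have hx := (h.memLp_dist_const x)
  -- Comparison with the constant map x gives d(x, E^λφ) ≤ 3/2 E[d(x, φ) | 𝓑] a.e., and real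
  -- conditional expectation preserves L^p.
  refine .of_memLp hm (x := x) ((hx.condExp (m := 𝓑) hp).of_le_mul (c := 3 / 2)
    (aestronglyMeasurable_const.dist (hm.mono h𝓑)) ?_)
  filter_upwards [h.1.ae_condExpKernel h𝓑, h1.ae_integrable_condExpKernel h𝓑,
    condExp_ae_eq_integral_condExpKernel h𝓑 (h1.integrable_dist_const x)] with ω a1 a2 a3
  rw [a3, Real.norm_of_nonneg dist_nonneg,
    Real.norm_of_nonneg (integral_nonneg fun _ => dist_nonneg)]
  exact dist_canonicalBarycenter_map_const_le hM a1.aemeasurable (a2 x)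

/-- The variance inequality for the barycentric conditional expectation. -/
theorem MemLpMetric.integral_sq_dist_barycentricCondExp_le (hM : IsGlobalNPC M) (h𝓑 : 𝓑 ≤ mΩ)
    (hφ : MemLpMetric mΩ 2 P φ) (hψ : MemLpMetric 𝓑 2 P ψ) :
    ∫ ω, dist (_root_.barycentricCondExp 𝓑 P φ ω) (ψ ω) ^ 2 ∂P ≤
      ∫ ω, dist (φ ω) (ψ ω) ^ 2 ∂P -
        ∫ ω, dist (φ ω) (_root_.barycentricCondExp 𝓑 P φ ω) ^ 2 ∂P := by
  have hE := hφ.barycentricCondExp hM h𝓑 one_le_two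
  set E := _root_.barycentricCondExp 𝓑 P φ with hEdef
  have h1 := hφ.mono_exponent one_le_two
  have i1 := (hφ.memLp_dist (hψ.of_le h𝓑)).integrable_sq
  have i2 := (hφ.memLp_dist (hE.of_le h𝓑)).integrable_sq
  have i3 := ((hE.of_le h𝓑).memLp_dist (hψ.of_le h𝓑)).integrable_sq
  have e := integral_integral_condExpKernel (𝓑 := 𝓑) h𝓑 (i1.sub i2)
  simp only [Pi.sub_apply] at e
  rw [← integral_sub i1 i2, ← e]
  obtain ⟨x, -⟩ := hφ.2
  refine integral_mono_ae i3 (i1.sub i2).integral_condExpKernel ?_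
  filter_upwards [h1.1.ae_condExpKernel h𝓑, h1.ae_integrable_condExpKernel h𝓑,
    hψ.1.ae_condExpKernel_eq h𝓑, hE.1.ae_condExpKernel_eq h𝓑] with ω a1 a2 a3 a4
  -- Under P_ω, ψ and E are a.s. equal to their values at ω, so this is the variance inequality at z
  -- = ψ ω.
  refine (sq_dist_canonicalBarycenter_map_le hM a1.aemeasurable (a2 x) (ψ ω)).2.trans_eq ?_
  refine integral_congr_ae ?_
  filter_upwards [a3, a4] with ω' b3 b4
  simp only [b3, b4, dist_comm (φ ω')]
  rfl

end BarycentricCondExp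

/-! ### Identification with Sturm's conditional expectation. -/

section SturmCondExp

variable {Ω M : Type*} {𝓑 : MeasurableSpace Ω} [mΩ : MeasurableSpace Ω] [StandardBorelSpace Ω]
  {P : Measure[mΩ] Ω} [IsProbabilityMeasure P] [MetricSpace M] [MeasurableSpace M] [BorelSpace M]
  [Nonempty M] {φ ψ : Ω → M}

theorem isSturmCondExp_barycentricCondExp (hM : IsGlobalNPC M) (h𝓑 : 𝓑 ≤ mΩ) :
    IsSturmCondExp 𝓑 P (barycentricCondExp 𝓑 P : (Ω → M) → (Ω → M)) where
  mapsTo φ h := h.barycentricCondExp hM h𝓑 le_rfl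
  continuous φ φs h hs hlim := by
    have := ENNReal.Tendsto.const_mul (a := ENNReal.ofReal (3 / 2)) hlim
      (Or.inr ENNReal.ofReal_ne_top)
    rw [mul_zero] at this
    exact tendsto_of_tendsto_of_tendsto_of_le_of_le tendsto_const_nhds this (fun _ => zero_le)
      fun k => (hs k).distLp_one_barycentricCondExp_le hM h𝓑 h
  argmin φ h := by
    have hE := h.barycentricCondExp hM h𝓑 one_le_two
    refine ⟨hE, fun ψ hψ => ?_⟩
    rw [distLp_two_le_iff (h.memLp_dist (hE.of_le h𝓑)) (h.memLp_dist (hψ.of_le h𝓑))]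
    have h1 := h.integral_sq_dist_barycentricCondExp_le hM h𝓑 hψ
    have h2 : 0 ≤ ∫ ω, dist (barycentricCondExp 𝓑 P φ ω) (ψ ω) ^ 2 ∂P :=
      integral_nonneg fun _ => sq_nonneg _
    linarith

/-- Take ψ = E φ in the integrated variance inequality: minimality of E φ makes its right side
nonpositive. -/
theorem IsSturmCondExp.ae_eq_of_memLp_two (hM : IsGlobalNPC M) (h𝓑 : 𝓑 ≤ mΩ)
    {E : (Ω → M) → (Ω → M)} (hE : IsSturmCondExp 𝓑 P E) (h : MemLpMetric mΩ 2 P φ) :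
    E φ =ᵐ[P] barycentricCondExp 𝓑 P φ := by
  obtain ⟨hm, hmin⟩ := hE.argmin φ h
  have hb := h.barycentricCondExp hM h𝓑 one_le_two
  have h1 := hmin _ hb
  rw [distLp_two_le_iff (h.memLp_dist (hm.of_le h𝓑)) (h.memLp_dist (hb.of_le h𝓑))] at h1
  have h2 := h.integral_sq_dist_barycentricCondExp_le hM h𝓑 hm
  have h3 : ∫ ω, dist (barycentricCondExp 𝓑 P φ ω) (E φ ω) ^ 2 ∂P = 0 :=
    le_antisymm (by linarith) (integral_nonneg fun _ => sq_nonneg _)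
  rw [integral_eq_zero_iff_of_nonneg (fun _ => sq_nonneg _)
    ((hb.of_le h𝓑).memLp_dist (hm.of_le h𝓑)).integrable_sq] at h3
  filter_upwards [h3] with ω hω
  exact (dist_eq_zero.1 ((pow_eq_zero_iff two_ne_zero).1 hω)).symm

/-- Sturm's conditional expectation is the barycentric one. -/
theorem IsSturmCondExp.ae_eq_barycentricCondExp (hM : IsGlobalNPC M) (h𝓑 : 𝓑 ≤ mΩ)
    {E : (Ω → M) → (Ω → M)} (hE : IsSturmCondExp 𝓑 P E) (h : MemLpMetric mΩ 1 P φ) :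
    E φ =ᵐ[P] barycentricCondExp 𝓑 P φ := by
  have hB := isSturmCondExp_barycentricCondExp (P := P) (M := M) hM h𝓑
  obtain ⟨φs, hφs⟩ := h.exists_simpleFunc_tendsto
  have hs : ∀ k, MemLpMetric mΩ 1 P (φs k) := fun k => memLpMetric_simpleFunc _
  have l1 := hE.continuous φ (fun k => φs k) h hs hφs
  have l2 := hB.continuous φ (fun k => φs k) h hs hφs
  have mE := ((hE.mapsTo φ h).of_le h𝓑).1
  have mB := ((hB.mapsTo φ h).of_le h𝓑).1
  refine ae_eq_of_distLp_one_eq_zero mE mB (le_antisymm ?_ zero_le)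
  have l3 := l1.add l2
  rw [add_zero] at l3
  refine ge_of_tendsto' l3 fun k => ?_
  -- Simple functions lie in L², where both maps agree; E (φs k) therefore tends to both candidates.
  have hk : distLp 1 P (barycentricCondExp 𝓑 P (φs k)) (barycentricCondExp 𝓑 P φ) =
      distLp 1 P (E (φs k)) (barycentricCondExp 𝓑 P φ) := by
    refine eLpNorm_congr_ae ?_
    filter_upwards [hE.ae_eq_of_memLp_two hM h𝓑 (memLpMetric_simpleFunc (φs k))] with ω hω
    rw [hω]
  rw [hk]
  exact distLp_one_triangle mE ((hE.mapsTo _ (hs k)).of_le h𝓑).1 mB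

end SturmCondExp

theorem theorem2p13 {Ω M : Type*} (𝓑 : MeasurableSpace Ω) [mΩ : MeasurableSpace Ω]
    [StandardBorelSpace Ω] (h𝓑 : 𝓑 ≤ mΩ) (P : Measure[mΩ] Ω) [IsProbabilityMeasure P]
    [MetricSpace M] [Nonempty M] [MeasurableSpace M] [BorelSpace M] (hM : IsGlobalNPC M) :
    -- the canonical barycentric map is well defined on `𝒫¹(M)`
    (∀ μ : Measure M, MemP1 μ → ∃! z : M, IsCanonicalBarycenter μ z) ∧
    -- Sturm's conditional expectation exists and is unique up to null sets
    IsSturmCondExp 𝓑 P (sturmCondExp 𝓑 P : (Ω → M) → (Ω → M)) ∧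
    (∀ E : (Ω → M) → (Ω → M), IsSturmCondExp 𝓑 P E →
      ∀ φ : Ω → M, MemLpMetric mΩ 1 P φ → E φ =ᵐ[P] sturmCondExp 𝓑 P φ) ∧
    -- the two conditional expectations coincide, in `L^p(Ω, 𝓑, P; M)`
    ∀ p : ℝ≥0∞, 1 ≤ p → ∀ φ : Ω → M, MemLpMetric mΩ p P φ →
      (∀ᵐ ω ∂P, MemP1 (Measure.map φ (condExpKernel P 𝓑 ω))) ∧
      MemLpMetric 𝓑 p P (barycentricCondExp 𝓑 P φ) ∧
      sturmCondExp 𝓑 P φ =ᵐ[P] barycentricCondExp 𝓑 P φ := by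
  have hB := isSturmCondExp_barycentricCondExp (P := P) (M := M) hM h𝓑
  have hS : IsSturmCondExp 𝓑 P (sturmCondExp 𝓑 P : (Ω → M) → (Ω → M)) :=
    Classical.epsilon_spec (p := IsSturmCondExp 𝓑 P) ⟨_, hB⟩
  refine ⟨fun μ hμ => ?_, hS, fun E hE φ hφ => ?_, fun p hp φ hφ => ?_⟩
  · have := hμ.prob
    obtain ⟨x, hx⟩ := hμ.integrable_dist
    exact existsUnique_isCanonicalBarycenter hM hx
  · exact (hE.ae_eq_barycentricCondExp hM h𝓑 hφ).trans
      (hS.ae_eq_barycentricCondExp hM h𝓑 hφ).symm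
  · have h1 := hφ.mono_exponent hp
    exact ⟨h1.ae_memP1 h𝓑, hφ.barycentricCondExp hM h𝓑 hp,
      hS.ae_eq_barycentricCondExp hM h𝓑 h1⟩
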